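/- Let $m,n,k,d$ be positive integers and $q$ a prime power such that $1\le k\le m$, $d\le n$, $d\le m$ and $q\ge m+d-2$. Then there exists an $\mathbb{F}_q$-$[n\times m,k,d]$ rank-metric code that is MTR (minimal tensor rank), that is, an $\mathbb{F}_q$-linear subspace $\mathcal{C}\le\mathbb{F}_q^{n\times m}$ with $\dim_{\mathbb{F}_q}(\mathcal{C})=k$, minimum rank distance $d(\mathcal{C})=\min\{\mathrm{rk}(X): X\in\mathcal{C},\,X\ne 0\}=d$, and tensor rank attaining Kruskal's lower bound $\mathrm{trk}(\mathcal{C})\ge\dim_{\mathbb{F}_q}(\mathcal{C})+d(\mathcal{C})-1$ with equality: \[\mathrm{trk}(\mathcal{C})=k+d-1.\] Here a tensor $X=(X_1\mid\cdots\mid X_k)\in\mathbb{F}_q^{k\times n\times m}$ is called a generator tensor of a $k$-dimensional subspace $\mathcal{C}$ if $\mathcal{C}$ is the span of its slices $X_1,\dots,X_k$; the tensor rank $\mathrm{trk}(X)$ is the least $R$ such that $X=\sum_{r=1}^R u_r\otimes v_r\otimes w_r$ for some $u_r\in\mathbb{F}_q^k$, $v_r\in\mathbb{F}_q^n$, $w_r\in\mathbb{F}_q^m$;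 and $\mathrm{trk}(\mathcal{C})$ is the tensor rank of any generator tensor of $\mathcal{C}$ (it does not depend on the choice). -/

import Mathlib

namespace RankMetric

/-- A 3-tensor in `K^{k × n × m}`, as the array `(X_1 | ⋯ | X_k)` of its `n × m` slices. -/
abbrev Tensor3 (K : Type*) (k n m : ℕ) : Type _ := Fin k → Matrix (Fin n) (Fin m) K

section Field

variable {K : Type*} [Field K] {k n m : ℕ}

/-- The coordinate array of the simple tensor `u ⊗ v ⊗ w`. -/
def simpleTensor (u : Fin k → K) (v : Fin n → K) (w : Fin m → K) : Tensor3 K k n m :=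
  fun l => Matrix.of fun i j => u l * v i * w j

/-- `X` is a sum of `R` simple tensors. -/
def IsSumOfSimple (X : Tensor3 K k n m) (R : ℕ) : Prop :=
  ∃ (u : Fin R → Fin k → K) (v : Fin R → Fin n → K) (w : Fin R → Fin m → K),
    X = ∑ r, simpleTensor (u r) (v r) (w r)

/-- The tensor rank: the least `R` such that `X` is a sum of `R` simple tensors. -/
noncomputable def tensorRank (X : Tensor3 K k n m) : ℕ :=
  sInf {R : ℕ | IsSumOfSimple X R}

/-- The first slice space of a tensor. -/
def firstSliceSpace (X : Tensor3 K k n m) : Submodule K (Matrix (Fin n) (Fin m) K) :=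
  Submodule.span K (Set.range X)

/-- A generator tensor of the space `V` of matrices: a tensor with exactly `dim V` slices whose
first slice space is `V`. -/
def IsGeneratorTensor (V : Submodule K (Matrix (Fin n) (Fin m) K))
    (X : Tensor3 K (Module.finrank K V) n m) : Prop :=
  firstSliceSpace X = V

/-- The generator tensor of `V` whose slices are a basis of `V`. -/
noncomputable def generatorTensor (V : Submodule K (Matrix (Fin n) (Fin m) K)) :
    Tensor3 K (Module.finrank K V) n m :=
  fun l => (Module.finBasis K V l : Matrix (Fin n) (Fin m) K)

/-- The tensor rank of a space of matrices: the tensor rank of a generator tensor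
(of any generator tensor, by `tensorRank_eq_trk`). -/
noncomputable def trk (V : Submodule K (Matrix (Fin n) (Fin m) K)) : ℕ :=
  tensorRank (generatorTensor V)

/-- The minimum rank distance of a code: the least rank of a nonzero element, and by convention
`n + 1` for the zero code. -/
noncomputable def minDist (C : Submodule K (Matrix (Fin n) (Fin m) K)) : ℕ :=
  open Classical in
  if C = ⊥ then n + 1
  else sInf {r : ℕ | ∃ X ∈ C, X ≠ 0 ∧ X.rank = r}

/-- `C` is a code with parameters `[n × m, k, d]`. -/
def HasParameters (C : Submodule K (Matrix (Fin n) (Fin m) K)) (k d : ℕ) : Prop :=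
  Module.finrank K C = k ∧ minDist C = d

/-- Minimal tensor rank: `C` attains the bound `trk C ≥ dim C + d(C) - 1`. (The subtraction is
never truncated, since `d(C) ≥ 1` for every `C`.) -/
def IsMTR (C : Submodule K (Matrix (Fin n) (Fin m) K)) : Prop :=
  trk C = Module.finrank K C + minDist C - 1

theorem generatorTensor_isGeneratorTensor (V : Submodule K (Matrix (Fin n) (Fin m) K)) :
    IsGeneratorTensor V (generatorTensor V) := by
  have h : Set.range (generatorTensor V) = V.subtype '' Set.range (Module.finBasis K V) := by
    rw [← Set.range_comp]; rfl
  rw [IsGeneratorTensor, firstSliceSpace, h, Submodule.span_image, (Module.finBasis K V).span_eq,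
    Submodule.map_subtype_top]

/-- Every tensor is a sum of simple tensors, so the tensor rank is an attained minimum. -/
theorem exists_isSumOfSimple (X : Tensor3 K k n m) : ∃ R, IsSumOfSimple X R := by
  let e := (Fintype.equivFin (Fin k × Fin n × Fin m)).symm
  refine ⟨_, fun r => Pi.single (e r).1 (X (e r).1 (e r).2.1 (e r).2.2),
    fun r => Pi.single (e r).2.1 1, fun r => Pi.single (e r).2.2 1, ?_⟩
  rw [Equiv.sum_comp e (fun p : Fin k × Fin n × Fin m =>
    simpleTensor (Pi.single p.1 (X p.1 p.2.1 p.2.2)) (Pi.single p.2.1 (1 : K))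
      (Pi.single p.2.2 (1 : K)))]
  ext l i j
  simp only [Finset.sum_apply, Matrix.sum_apply, simpleTensor, Matrix.of_apply, Pi.single_apply,
    Fintype.sum_prod_type]
  simp

theorem tensorRank_spec (X : Tensor3 K k n m) : IsSumOfSimple X (tensorRank X) :=
  Nat.sInf_mem (exists_isSumOfSimple X)

theorem tensorRank_mono {k' : ℕ} {X : Tensor3 K k n m} {Y : Tensor3 K k' n m}
    (h : firstSliceSpace X ≤ firstSliceSpace Y) : tensorRank X ≤ tensorRank Y := by
  obtain ⟨u, v, w, hY⟩ := tensorRank_spec Y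
  have hX : ∀ l, ∃ c : Fin k' → K, ∑ p, c p • Y p = X l := fun l =>
    (Submodule.mem_span_range_iff_exists_fun K).1 (h (Submodule.subset_span ⟨l, rfl⟩))
  choose c hc using hX
  refine Nat.sInf_le ⟨fun r l => ∑ p, c l p * u r p, v, w, ?_⟩
  have hY' : ∀ p i j, Y p i j = ∑ r, u r p * v r i * w r j := by
    intro p i j
    conv_lhs => rw [hY]
    simp only [Finset.sum_apply, Matrix.sum_apply, simpleTensor, Matrix.of_apply]
  ext l i j
  rw [← hc l]
  simp only [Finset.sum_apply, Matrix.sum_apply, simpleTensor, Matrix.of_apply, Matrix.smul_apply,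
    smul_eq_mul, hY', Finset.mul_sum, Finset.sum_mul]
  rw [Finset.sum_comm]
  exact Finset.sum_congr rfl fun r _ => Finset.sum_congr rfl fun p _ => by ring

/-- The tensor rank of a space does not depend on the generator tensor. -/
theorem tensorRank_eq_trk (V : Submodule K (Matrix (Fin n) (Fin m) K))
    (X : Tensor3 K (Module.finrank K V) n m) (hX : IsGeneratorTensor V X) :
    tensorRank X = trk V := by
  have h : firstSliceSpace X = firstSliceSpace (generatorTensor V) :=
    hX.trans (generatorTensor_isGeneratorTensor V).symm
  exact le_antisymm (tensorRank_mono h.le) (tensorRank_mono h.ge)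

end Field

end RankMetric

/-!
The bound `trk C ≤ R` means that `C` lies in the span of `R` matrices of rank at most one.
Lifting `C` to a linear code of length `trk C` turns Kruskal's bound into the Singleton bound,
because the rank of a combination of such matrices is at most the weight of its coefficients.
Hence a `k`-dimensional code all of whose nonzero elements have rank at least `d` is MTR with
minimum distance `d` as soon as it lies in the span of `k + d - 1` rank-one matrices.

Such a code comes from a simple extension `L` of degree `m`, generated by `θ`: take the matrices of
`F[X]_{<d} → L`, `p ↦ g * p(θ)`, for `g` in the span of `1, θ, …, θ ^ (k - 1)`. Multiplication by
`g ≠ 0` is injective, which gives rank `d`. A product `f * p` with `deg f < k` and `deg p < d` is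
interpolated from its values at `k + d - 2` points of `F` and at infinity, and each of these values
is the product of a value of `f` and a value of `p`, hence contributes one rank-one matrix.
-/

namespace RankMetric

open Matrix Module Polynomial

section Kruskal

/-- The Singleton bound. -/
theorem exists_mem_ne_zero_hammingNorm_add_finrank_le {K ι : Type*} [DivisionRing K]
    [DecidableEq K] [Fintype ι] {W : Submodule K (ι → K)} (hW : W ≠ ⊥) :
    ∃ c ∈ W, c ≠ 0 ∧ hammingNorm c + finrank K W ≤ Fintype.card ι + 1 := by
  classical
  have hpos : 0 < finrank K W := Submodule.one_le_finrank_iff.2 hW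
  have hle : finrank K W ≤ Fintype.card ι := by simpa using W.finrank_le
  obtain ⟨s, -, hs⟩ := Finset.exists_subset_card_eq (s := (Finset.univ : Finset ι))
    (n := finrank K W - 1) (by rw [Finset.card_univ]; omega)
  let restriction : W →ₗ[K] s → K := LinearMap.funLeft K K Subtype.val ∘ₗ W.subtype
  have hker : LinearMap.ker restriction ≠ ⊥ := LinearMap.ker_ne_bot_of_finrank_lt <| by
    rw [finrank_fintype_fun_eq_card, Fintype.card_coe]
    omega
  obtain ⟨c, hc, hc0⟩ := Submodule.exists_mem_ne_zero_of_ne_bot hker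
  have hvanish : ∀ i ∈ s, (c : ι → K) i = 0 := fun i hi =>
    congrFun (LinearMap.mem_ker.1 hc) ⟨i, hi⟩
  have hweight : hammingNorm (c : ι → K) ≤ sᶜ.card := Finset.card_le_card fun i hi =>
    Finset.mem_compl.2 fun his => (Finset.mem_filter.1 hi).2 (hvanish i his)
  refine ⟨c, c.2, by simpa using hc0, ?_⟩
  rw [Finset.card_compl] at hweight
  omega

variable {K : Type*} [Field K]

theorem rank_sum_smul_vecMulVec_le_hammingNorm {ι α β : Type*} [Fintype ι] [Fintype β]
    [DecidableEq K] (c : ι → K) (v : ι → α → K) (w : ι → β → K) :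
    (∑ r, c r • vecMulVec (v r) (w r)).rank ≤ hammingNorm c := by
  classical
  have hfactor : ∑ r, c r • vecMulVec (v r) (w r) = (of v)ᵀ * (diagonal c * of w) := by
    ext i j
    rw [Matrix.sum_apply, Matrix.mul_apply]
    simp only [Matrix.smul_apply, vecMulVec_apply, diagonal_mul, transpose_apply, of_apply,
      smul_eq_mul]
    exact Finset.sum_congr rfl fun r _ => mul_left_comm _ _ _
  calc (∑ r, c r • vecMulVec (v r) (w r)).rank
      ≤ (diagonal c).rank := by
        rw [hfactor]
        exact (rank_mul_le_right _ _).trans (rank_mul_le_left _ _)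
    _ = hammingNorm c := by rw [rank_diagonal, Fintype.card_subtype, hammingNorm]

theorem exists_mem_ne_zero_rank_add_finrank_le {ι α β : Type*} [Fintype ι] [Fintype β]
    {V : Submodule K (Matrix α β K)} (hV : V ≠ ⊥) {v : ι → α → K} {w : ι → β → K}
    (hspan : V ≤ Submodule.span K (Set.range fun r => vecMulVec (v r) (w r))) :
    ∃ Y ∈ V, Y ≠ 0 ∧ Y.rank + finrank K V ≤ Fintype.card ι + 1 := by
  classical
  let combine := Fintype.linearCombination K fun r => vecMulVec (v r) (w r)
  have hrange : V ≤ LinearMap.range combine := by rwa [Fintype.range_linearCombination]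
  obtain ⟨lift, hlift⟩ : ∃ lift : V →ₗ[K] ι → K, combine ∘ₗ lift = V.subtype := by
    obtain ⟨lift, hlift⟩ := projective_lifting_property combine.rangeRestrict
      (Submodule.inclusion hrange) combine.surjective_rangeRestrict
    exact ⟨lift, congrArg ((LinearMap.range combine).subtype ∘ₗ ·) hlift⟩
  have hinj : Function.Injective lift := by
    refine Function.Injective.of_comp (f := combine) ?_
    rw [← LinearMap.coe_comp, hlift]
    exact V.injective_subtype
  have hfinrank : finrank K (LinearMap.range lift) = finrank K V :=
    LinearMap.finrank_range_of_inj hinj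
  have : Module.Finite K V := Module.Finite.of_injective lift hinj
  have hne : LinearMap.range lift ≠ ⊥ := by
    rwa [← Submodule.one_le_finrank_iff, hfinrank, Submodule.one_le_finrank_iff]
  obtain ⟨_, ⟨Y, rfl⟩, hY0, hY⟩ := exists_mem_ne_zero_hammingNorm_add_finrank_le hne
  have hrank : (Y : Matrix α β K).rank ≤ hammingNorm (lift Y) := by
    rw [← V.subtype_apply, ← hlift]
    exact rank_sum_smul_vecMulVec_le_hammingNorm (lift Y) v w
  have hYne : (Y : Matrix α β K) ≠ 0 := fun h => hY0 (by rw [Submodule.coe_eq_zero.1 h, map_zero])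
  exact ⟨Y, Y.2, hYne, by omega⟩

variable {k n m : ℕ}

theorem sum_simpleTensor_apply {R : ℕ} (u : Fin R → Fin k → K) (v : Fin R → Fin n → K)
    (w : Fin R → Fin m → K) (l : Fin k) :
    (∑ r, simpleTensor (u r) (v r) (w r)) l = ∑ r, u r l • vecMulVec (v r) (w r) := by
  ext i j
  simp only [Finset.sum_apply, Matrix.sum_apply, simpleTensor, of_apply, Matrix.smul_apply,
    vecMulVec_apply, smul_eq_mul, mul_assoc]

theorem isSumOfSimple_iff_firstSliceSpace_le {X : Tensor3 K k n m} {R : ℕ} :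
    IsSumOfSimple X R ↔ ∃ (v : Fin R → Fin n → K) (w : Fin R → Fin m → K),
      firstSliceSpace X ≤ Submodule.span K (Set.range fun r => vecMulVec (v r) (w r)) := by
  simp only [firstSliceSpace, Submodule.span_le, Set.range_subset_iff, SetLike.mem_coe,
    Submodule.mem_span_range_iff_exists_fun]
  constructor
  · rintro ⟨u, v, w, rfl⟩
    exact ⟨v, w, fun l => ⟨fun r => u r l, (sum_simpleTensor_apply u v w l).symm⟩⟩
  · rintro ⟨v, w, h⟩
    choose c hc using h
    exact ⟨fun r l => c l r, v, w, funext fun l => by rw [sum_simpleTensor_apply, hc]⟩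

theorem exists_le_span_vecMulVec_trk (V : Submodule K (Matrix (Fin n) (Fin m) K)) :
    ∃ (v : Fin (trk V) → Fin n → K) (w : Fin (trk V) → Fin m → K),
      V ≤ Submodule.span K (Set.range fun r => vecMulVec (v r) (w r)) := by
  have h := isSumOfSimple_iff_firstSliceSpace_le.1 (tensorRank_spec (generatorTensor V))
  rwa [generatorTensor_isGeneratorTensor V] at h

theorem trk_le_card_of_le_span_vecMulVec {ι : Type*} [Fintype ι]
    {V : Submodule K (Matrix (Fin n) (Fin m) K)} {v : ι → Fin n → K} {w : ι → Fin m → K}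
    (hspan : V ≤ Submodule.span K (Set.range fun r => vecMulVec (v r) (w r))) :
    trk V ≤ Fintype.card ι := by
  let e := (Fintype.equivFin ι).symm
  refine Nat.sInf_le (isSumOfSimple_iff_firstSliceSpace_le.2 ⟨v ∘ e, w ∘ e, ?_⟩)
  rw [generatorTensor_isGeneratorTensor V]
  exact hspan.trans_eq (congrArg _ (e.surjective.range_comp _).symm)

variable {C : Submodule K (Matrix (Fin n) (Fin m) K)}

theorem minDist_le_rank {Y : Matrix (Fin n) (Fin m) K} (hY : Y ∈ C) (hY0 : Y ≠ 0) :
    minDist C ≤ Y.rank := by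
  have hC : C ≠ ⊥ := (Submodule.ne_bot_iff C).2 ⟨Y, hY, hY0⟩
  rw [minDist, if_neg hC]
  exact Nat.sInf_le ⟨Y, hY, hY0, rfl⟩

theorem le_minDist (hC : C ≠ ⊥) {d : ℕ} (hd : ∀ Y ∈ C, Y ≠ 0 → d ≤ Y.rank) : d ≤ minDist C := by
  obtain ⟨Y, hY, hY0⟩ := C.exists_mem_ne_zero_of_ne_bot hC
  rw [minDist, if_neg hC]
  refine le_csInf ⟨_, Y, hY, hY0, rfl⟩ ?_
  rintro _ ⟨Z, hZ, hZ0, rfl⟩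
  exact hd Z hZ hZ0

/-- Kruskal's bound. It fails for the zero code, whose distance is `n + 1` by convention. -/
theorem finrank_add_minDist_le_trk_add_one (hC : C ≠ ⊥) :
    finrank K C + minDist C ≤ trk C + 1 := by
  obtain ⟨v, w, hspan⟩ := exists_le_span_vecMulVec_trk C
  obtain ⟨Y, hY, hY0, hrank⟩ := exists_mem_ne_zero_rank_add_finrank_le hC hspan
  have hdist := minDist_le_rank hY hY0
  rw [Fintype.card_fin] at hrank
  omega

theorem hasParameters_and_isMTR_of_trk_add_one_le {k d : ℕ} (hC : C ≠ ⊥)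
    (hk : finrank K C = k) (hd : ∀ Y ∈ C, Y ≠ 0 → d ≤ Y.rank) (htrk : trk C + 1 ≤ k + d) :
    HasParameters C k d ∧ IsMTR C := by
  have hkruskal := finrank_add_minDist_le_trk_add_one hC
  have hdist := le_minDist hC hd
  rw [HasParameters, IsMTR]
  omega

end Kruskal

section Interpolation

variable {F : Type*} [Field F]

theorem eq_interpolate_add_coeff_mul_nodal {ι : Type*} [DecidableEq ι] {s : Finset ι} {v : ι → F}
    (hv : Set.InjOn v s) {f : F[X]} (hf : f.natDegree ≤ s.card) :
    f = Lagrange.interpolate s v (fun i => f.eval (v i)) +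
      C (f.coeff s.card) * Lagrange.nodal s v := by
  have hnodal : (Lagrange.nodal s v).natDegree = s.card := Lagrange.natDegree_nodal
  have hlead : (Lagrange.nodal s v).coeff s.card = 1 := by
    rw [← hnodal]
    exact Lagrange.nodal_monic.coeff_natDegree
  rw [← sub_eq_iff_eq_add]
  refine Lagrange.eq_interpolate_of_eval_eq _ hv ?_ fun i hi => ?_
  · rw [degree_lt_iff_coeff_zero]
    intro N hN
    rw [coeff_sub, coeff_C_mul]
    rcases hN.eq_or_lt with rfl | hN
    · rw [hlead, mul_one, sub_self]
    · rw [coeff_eq_zero_of_natDegree_lt (hf.trans_lt hN),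
        coeff_eq_zero_of_natDegree_lt (hnodal.trans_lt hN), mul_zero, sub_zero]
  · rw [eval_sub, eval_mul, Lagrange.eval_nodal_at_node hi, mul_zero, sub_zero]

/-- Evaluation at the points of `s` and at infinity (`none`), where the value at infinity of a
polynomial of degree at most `e` is its coefficient of degree `e`. -/
def evalProj (s : Finset F) (e : ℕ) (f : F[X]) : Option s → F
  | none => f.coeff e
  | some a => f.eval (a : F)

/-- The polynomials that interpolate at the points of `s` and at infinity (`none`): the Lagrange
basis of `s` and the nodal polynomial. -/
noncomputable def interpolationBasis [DecidableEq F] (s : Finset F) : Option s → F[X]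
  | none => Lagrange.nodal s id
  | some a => Lagrange.basis s id (a : F)

theorem mul_eq_sum_evalProj_mul_smul_interpolationBasis [DecidableEq F] {s : Finset F}
    {f g : F[X]} {a b : ℕ} (hf : f.natDegree ≤ a) (hg : g.natDegree ≤ b) (hs : s.card = a + b) :
    f * g = ∑ r, (evalProj s a f r * evalProj s b g r) • interpolationBasis s r := by
  have hfg : (f * g).natDegree ≤ s.card := hs ▸ natDegree_mul_le_of_le hf hg
  conv_lhs => rw [eq_interpolate_add_coeff_mul_nodal Function.injective_id.injOn hfg]
  rw [Fintype.sum_option, add_comm, Lagrange.interpolate_apply, ← Finset.sum_coe_sort, hs,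
    coeff_mul_add_eq_of_natDegree_le hf hg]
  simp only [evalProj, interpolationBasis, smul_eq_C_mul, id, eval_mul]

end Interpolation

section MultiplicationCode

variable {F L : Type*} [Field F] [Ring L] [Algebra F L]

section MulMatrix

variable {ι κ : Type*}

/-- The matrix whose rows are the coordinates of the products `g * x i` in the basis `b`. -/
noncomputable def mulMatrix [Finite κ] (b : Basis κ F L) (x : ι → L) : L →ₗ[F] Matrix ι κ F where
  toFun g := of fun i => b.equivFun (g * x i)
  map_add' g h := by ext; simp [add_mul]
  map_smul' c g := by ext; simp

theorem rank_mulMatrix [NoZeroDivisors L] [Finite ι] [Fintype κ] (b : Basis κ F L) (x : ι → L)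
    {g : L} (hg : g ≠ 0) : (mulMatrix b x g).rank = (Set.range x).finrank F := by
  let φ : L →ₗ[F] κ → F := b.equivFun.toLinearMap ∘ₗ LinearMap.mulLeft F g
  have hφ : Function.Injective φ := b.equivFun.injective.comp (mul_right_injective₀ hg)
  have hrow : (mulMatrix b x g).row = φ ∘ x := rfl
  rw [rank_eq_finrank_span_row, hrow, Set.range_comp, Submodule.span_image, Set.finrank]
  exact (Submodule.equivMapOfInjective φ hφ _).finrank_eq.symm

theorem mulMatrix_aeval_eq_sum [Finite κ] [DecidableEq F] (b : Basis κ F L) (θ : L) {s : Finset F}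
    {f : F[X]} {p : ι → F[X]} {a e : ℕ} (hf : f.natDegree ≤ a) (hp : ∀ i, (p i).natDegree ≤ e)
    (hs : s.card = a + e) :
    mulMatrix b (fun i => aeval θ (p i)) (aeval θ f) =
      ∑ r, evalProj s a f r • vecMulVec (fun i => evalProj s e (p i) r)
        (b.equivFun (aeval θ (interpolationBasis s r))) := by
  ext i j
  have hprod : aeval θ f * aeval θ (p i) =
      ∑ r, (evalProj s a f r * evalProj s e (p i) r) • aeval θ (interpolationBasis s r) := by
    rw [← map_mul, mul_eq_sum_evalProj_mul_smul_interpolationBasis hf (hp i) hs, map_sum]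
    simp only [map_smul]
  simp only [mulMatrix, LinearMap.coe_mk, AddHom.coe_mk, of_apply, hprod, map_sum, map_smul,
    Finset.sum_apply, Pi.smul_apply, Matrix.sum_apply, Matrix.smul_apply, vecMulVec_apply,
    smul_eq_mul, mul_assoc]

end MulMatrix

/-- The monomials `1, X, …, X ^ (d - 1)`, padded with zeros to a vector of length `n`. -/
noncomputable def paddedMonomials (F : Type*) [Field F] (n d : ℕ) (i : Fin n) : F[X] :=
  if (i : ℕ) < d then X ^ (i : ℕ) else 0

theorem natDegree_paddedMonomials_le {n d : ℕ} (i : Fin n) :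
    (paddedMonomials F n d i).natDegree ≤ d - 1 := by
  by_cases hi : (i : ℕ) < d
  · rw [paddedMonomials, if_pos hi, natDegree_X_pow]
    omega
  · rw [paddedMonomials, if_neg hi, natDegree_zero]
    exact Nat.zero_le _

/-- The code of the matrices, in the power basis, of the multiplications `F[X]_{<d} → L`,
`p ↦ g * p(θ)`, for `g` in the span of the first `k` powers of the generator `θ`. Zero rows are
added to reach height `n`. -/
noncomputable def multiplicationCode (pb : PowerBasis F L) (n k d : ℕ) :
    Submodule F (Matrix (Fin n) (Fin pb.dim) F) :=
  (Submodule.span F (Set.range fun l : Fin k => pb.gen ^ (l : ℕ))).map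
    (mulMatrix pb.basis fun i => aeval pb.gen (paddedMonomials F n d i))

variable {pb : PowerBasis F L} {n k d : ℕ}

theorem linearIndependent_gen_pow (hk : k ≤ pb.dim) :
    LinearIndependent F fun l : Fin k => pb.gen ^ (l : ℕ) := by
  have h := pb.basis.linearIndependent.comp _ (Fin.castLE_injective hk)
  rwa [PowerBasis.coe_basis] at h

theorem finrank_span_gen_pow (hk : k ≤ pb.dim) :
    finrank F (Submodule.span F (Set.range fun l : Fin k => pb.gen ^ (l : ℕ))) = k := by
  rw [finrank_span_eq_card (linearIndependent_gen_pow hk), Fintype.card_fin]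

theorem le_finrank_range_aeval_paddedMonomials (hdn : d ≤ n) (hdm : d ≤ pb.dim) :
    d ≤ (Set.range fun i : Fin n => aeval pb.gen (paddedMonomials F n d i)).finrank F := by
  have hsub : (Set.range fun i : Fin d => pb.gen ^ (i : ℕ)) ⊆
      Set.range fun i : Fin n => aeval pb.gen (paddedMonomials F n d i) := by
    rintro _ ⟨i, rfl⟩
    refine ⟨Fin.castLE hdn i, ?_⟩
    simp only [paddedMonomials, Fin.val_castLE, i.2, if_true, map_pow, aeval_X]
  have := Module.Finite.span_of_finite F
    (Set.finite_range fun i : Fin n => aeval pb.gen (paddedMonomials F n d i))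
  exact (finrank_span_gen_pow hdm).ge.trans (Submodule.finrank_mono (Submodule.span_mono hsub))

theorem le_rank_of_mem_multiplicationCode [NoZeroDivisors L] (hdn : d ≤ n) (hdm : d ≤ pb.dim)
    {Y : Matrix (Fin n) (Fin pb.dim) F} (hY : Y ∈ multiplicationCode pb n k d) (hY0 : Y ≠ 0) :
    d ≤ Y.rank := by
  obtain ⟨g, -, rfl⟩ := hY
  have hg : g ≠ 0 := by
    rintro rfl
    exact hY0 (map_zero _)
  exact (le_finrank_range_aeval_paddedMonomials hdn hdm).trans_eq (rank_mulMatrix _ _ hg).symm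

theorem finrank_multiplicationCode [NoZeroDivisors L] (hd : 0 < d) (hdn : d ≤ n)
    (hdm : d ≤ pb.dim) (hkm : k ≤ pb.dim) : finrank F (multiplicationCode pb n k d) = k := by
  have hinj : Function.Injective (mulMatrix pb.basis fun i : Fin n =>
      aeval pb.gen (paddedMonomials F n d i)) := by
    refine (injective_iff_map_eq_zero _).2 fun g hg => by_contra fun hg0 => ?_
    have hrank := (le_finrank_range_aeval_paddedMonomials hdn hdm).trans_eq
      (rank_mulMatrix pb.basis _ hg0).symm
    rw [hg, rank_zero] at hrank
    omega
  rw [multiplicationCode, ← (Submodule.equivMapOfInjective _ hinj _).finrank_eq,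
    finrank_span_gen_pow hkm]

theorem multiplicationCode_le_span_vecMulVec [DecidableEq F] {s : Finset F}
    (hs : s.card = (k - 1) + (d - 1)) :
    multiplicationCode pb n k d ≤ Submodule.span F (Set.range fun r : Option s =>
      vecMulVec (fun i => evalProj s (d - 1) (paddedMonomials F n d i) r)
        (pb.basis.equivFun (aeval pb.gen (interpolationBasis s r)))) := by
  rw [multiplicationCode, Submodule.map_span_le, Set.forall_mem_range]
  intro l
  have hdeg : ((X : F[X]) ^ (l : ℕ)).natDegree ≤ k - 1 := by
    rw [natDegree_X_pow]
    omega
  have heval : pb.gen ^ (l : ℕ) = aeval pb.gen ((X : F[X]) ^ (l : ℕ)) := by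
    rw [map_pow, aeval_X]
  rw [heval, mulMatrix_aeval_eq_sum pb.basis pb.gen hdeg natDegree_paddedMonomials_le hs]
  exact (Submodule.mem_span_range_iff_exists_fun F).2 ⟨_, rfl⟩

theorem trk_multiplicationCode_add_one_le (hk : 0 < k) (hd : 0 < d)
    (hF : ((k + d - 2 : ℕ) : Cardinal) ≤ Cardinal.mk F) :
    trk (multiplicationCode pb n k d) + 1 ≤ k + d := by
  classical
  obtain ⟨s, hs⟩ := Cardinal.exists_finset_eq_card hF
  have hcard : s.card = (k - 1) + (d - 1) := by omega
  have htrk := trk_le_card_of_le_span_vecMulVec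
    (multiplicationCode_le_span_vecMulVec (pb := pb) (n := n) hcard)
  rw [Fintype.card_option, Fintype.card_coe] at htrk
  omega

theorem hasParameters_and_isMTR_multiplicationCode [NoZeroDivisors L] (hk : 0 < k) (hd : 0 < d)
    (hkm : k ≤ pb.dim) (hdn : d ≤ n) (hdm : d ≤ pb.dim)
    (hF : ((k + d - 2 : ℕ) : Cardinal) ≤ Cardinal.mk F) :
    HasParameters (multiplicationCode pb n k d) k d ∧ IsMTR (multiplicationCode pb n k d) := by
  have hfinrank := finrank_multiplicationCode (n := n) hd hdn hdm hkm
  have hne : multiplicationCode pb n k d ≠ ⊥ := Submodule.one_le_finrank_iff.1 (by omega)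
  exact hasParameters_and_isMTR_of_trk_add_one_le hne hfinrank
    (fun _ hY hY0 => le_rank_of_mem_multiplicationCode hdn hdm hY hY0)
    (trk_multiplicationCode_add_one_le hk hd hF)

end MultiplicationCode

theorem exists_irreducible_natDegree_eq (F : Type*) [Field F] [Finite F] {m : ℕ} (hm : 0 < m) :
    ∃ f : F[X], Irreducible f ∧ f.natDegree = m := by
  obtain ⟨p, hp⟩ := CharP.exists F
  have : Fact p.Prime := ⟨CharP.char_is_prime F p⟩
  have : NeZero m := ⟨hm.ne'⟩
  let pb := Field.powerBasisOfFiniteOfSeparable F (FiniteField.Extension F p m)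
  refine ⟨minpoly F pb.gen, minpoly.irreducible pb.isIntegral_gen, ?_⟩
  rw [pb.natDegree_minpoly, ← pb.finrank, FiniteField.finrank_extension]

end RankMetric

theorem mainTheorem3_general {F : Type*} [Field F] {f : Polynomial F} (hf : Irreducible f)
    {n k d : ℕ} (hk : 0 < k) (hd : 0 < d) (hkf : k ≤ f.natDegree) (hdn : d ≤ n)
    (hdf : d ≤ f.natDegree) (hF : ((k + d - 2 : ℕ) : Cardinal) ≤ Cardinal.mk F) :
    ∃ C : Submodule F (Matrix (Fin n) (Fin f.natDegree) F),
      RankMetric.HasParameters C k d ∧ RankMetric.IsMTR C := by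
  have : Fact (Irreducible f) := ⟨hf⟩
  rw [← AdjoinRoot.powerBasis_dim hf.ne_zero] at hkf hdf ⊢
  exact ⟨_, RankMetric.hasParameters_and_isMTR_multiplicationCode hk hd hkf hdn hdf hF⟩

theorem mainTheorem3 (q : ℕ) (F : Type*) [Field F] [Finite F] (hF : Nat.card F = q)
    (m n k d : ℕ) (hm : 0 < m) (hn : 0 < n) (hd : 0 < d)
    (hk : 1 ≤ k) (hkm : k ≤ m) (hdn : d ≤ n) (hdm : d ≤ m) (hq : m + d - 2 ≤ q) :
    ∃ C : Submodule F (Matrix (Fin n) (Fin m) F),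
      RankMetric.HasParameters C k d ∧ RankMetric.IsMTR C := by
  obtain ⟨f, hf, rfl⟩ := RankMetric.exists_irreducible_natDegree_eq F hm
  exact mainTheorem3_general hf hk hd hkm hdn hdm (by rw [← Nat.cast_card]; norm_cast; omega)
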